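/- Let $(X,\rho)$ be a complete separable metric space whose metric is an ultrametric, that is, $\rho(x,z)\le\max\{\rho(x,y),\rho(y,z)\}$ for all $x,y,z\in X$, and let $0<p<\infty$. Let $\mathcal{W}_p(X)$ be the set of all Borel probability measures $\mu$ on $X$ such that $\int_X\rho(x,\hat x)^p\,\mathrm{d}\mu(x)<\infty$ for some (hence all) $\hat x\in X$, endowed with the $p$-Wasserstein distance $$d_{\mathcal{W}_p}(\mu,\nu)=\Big(\inf_{\pi\in\Pi(\mu,\nu)}\int_{X\times X}\rho(x,y)^p\,\mathrm{d}\pi(x,y)\Big)^{\min\{1/p,\,1\}},$$ where $\Pi(\mu,\nu)$ is the set of all Borel probability measures on $X\times X$ with first marginal $\mu$ and second marginal $\nu$. Let $\Phi\colon\mathcal{W}_p(X)\to\mathcal{W}_p(X)$ be an isometry, that is, a distance preserving bijection. Then there exists an isometry (distance preserving bijection) $\psi\colon X\to X$ such that $$\Phi(\mu)=\psi_\#\mu\qquad\text{for all }\mu\in\mathcal{W}_p(X),$$ where $\psi_\#\mu(A)=\mu(\psi^{-1}[A])$ for every Borel set $A\subseteq X$. -/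

import Mathlib

open MeasureTheory
open scoped ENNReal

/-- The set of couplings (transport plans) of two Borel measures on `X`: the measures on `X × X`
whose first marginal is `μ` and whose second marginal is `ν`. -/
def couplings {X : Type*} [MeasurableSpace X] (μ ν : Measure X) : Set (Measure (X × X)) :=
  {π | π.fst = μ ∧ π.snd = ν}

/-- The underlying set of the `p`-Wasserstein space: the Borel probability measures `μ` on `X` with
`∫ ρ(x, x₀)^p dμ(x) < ∞` for some base point `x₀`. -/
def WassersteinSpace (p : ℝ) (X : Type*) [MetricSpace X] [MeasurableSpace X] : Type _ :=
  {μ : ProbabilityMeasure X // ∃ x₀ : X, ∫⁻ x, edist x x₀ ^ p ∂(μ : Measure X) < ∞}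

namespace WassersteinSpace

/-- The Borel measure on `X` underlying a point of the Wasserstein space. -/
def toMeasure {p : ℝ} {X : Type*} [MetricSpace X] [MeasurableSpace X]
    (μ : WassersteinSpace p X) : Measure X :=
  (μ.1 : Measure X)

/-- The `p`-Wasserstein distance
`(inf over couplings π of ∫ ρ(x, y)^p dπ(x, y)) ^ min(1/p, 1)`,
as an element of `[0, ∞]`; it is finite for `0 < p`, see `wassersteinDist_lt_top`. -/
noncomputable def wassersteinDist {p : ℝ} {X : Type*} [MetricSpace X] [MeasurableSpace X]
    (μ ν : WassersteinSpace p X) : ℝ≥0∞ :=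
  (⨅ π ∈ couplings μ.toMeasure ν.toMeasure, ∫⁻ z, edist z.1 z.2 ^ p ∂π) ^ min (1 / p) 1

theorem wassersteinDist_lt_top {p : ℝ} (hp : 0 < p) {X : Type*} [MetricSpace X]
    [MeasurableSpace X] [BorelSpace X] (μ ν : WassersteinSpace p X) :
    wassersteinDist μ ν < ∞ := by
  obtain ⟨μ, x₀, hx⟩ := μ
  obtain ⟨ν, y₀, hy⟩ := ν
  refine ENNReal.rpow_lt_top_of_nonneg (by positivity) (ne_of_lt ?_)
  have hc : (μ : Measure X).prod (ν : Measure X) ∈ couplings (μ : Measure X) (ν : Measure X) :=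
    ⟨by simp, by simp⟩
  refine lt_of_le_of_lt (iInf₂_le _ hc) ?_
  have mx : Measurable fun z : X × X => edist z.1 x₀ ^ p := by fun_prop
  have my : Measurable fun z : X × X => edist z.2 y₀ ^ p := by fun_prop
  have hmax : ∀ a b : ℝ≥0∞, (a + b) ^ p ≤ 2 ^ p * (a ^ p + b ^ p) := by
    intro a b
    have h2 : a + b ≤ 2 * max a b := by
      rw [two_mul]; exact add_le_add (le_max_left _ _) (le_max_right _ _)
    refine (ENNReal.rpow_le_rpow h2 hp.le).trans ?_
    rw [ENNReal.mul_rpow_of_nonneg _ _ hp.le]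
    gcongr
    rcases le_total a b with h | h
    · rw [max_eq_right h]; exact le_add_self
    · rw [max_eq_left h]; exact le_self_add
  have hle : ∀ z : X × X, edist z.1 z.2 ^ p ≤
      2 ^ p * (edist z.1 x₀ ^ p + 2 ^ p * (edist z.2 y₀ ^ p + edist y₀ x₀ ^ p)) := by
    intro z
    have h1 : edist z.1 z.2 ≤ edist z.1 x₀ + (edist z.2 y₀ + edist y₀ x₀) := by
      refine (edist_triangle _ x₀ _).trans ?_
      rw [edist_comm x₀ z.2]
      gcongr
      exact edist_triangle _ _ _
    refine (ENNReal.rpow_le_rpow h1 hp.le).trans ((hmax _ _).trans ?_)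
    gcongr
    exact hmax _ _
  have c2 : (2 : ℝ≥0∞) ^ p ≠ ∞ := ENNReal.rpow_ne_top_of_nonneg hp.le (by simp)
  have c3 : edist y₀ x₀ ^ p ≠ ∞ := ENNReal.rpow_ne_top_of_nonneg hp.le (edist_ne_top _ _)
  refine lt_of_le_of_lt (lintegral_mono hle) ?_
  rw [lintegral_const_mul' _ _ c2, lintegral_add_left mx, lintegral_const_mul' _ _ c2,
    lintegral_add_left my]
  have e1 : ∫⁻ z, edist z.1 x₀ ^ p ∂((μ : Measure X).prod (ν : Measure X)) =
      ∫⁻ x, edist x x₀ ^ p ∂(μ : Measure X) := by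
    rw [lintegral_prod _ mx.aemeasurable]; simp
  have e2 : ∫⁻ z, edist z.2 y₀ ^ p ∂((μ : Measure X).prod (ν : Measure X)) =
      ∫⁻ y, edist y y₀ ^ p ∂(ν : Measure X) := by
    rw [lintegral_prod _ my.aemeasurable]; simp
  rw [e1, e2]
  simp only [lintegral_const, measure_univ, mul_one]
  exact ENNReal.mul_lt_top c2.lt_top (ENNReal.add_lt_top.2 ⟨hx, ENNReal.mul_lt_top c2.lt_top
    (ENNReal.add_lt_top.2 ⟨hy, c3.lt_top⟩)⟩)

end WassersteinSpace

/-! An isometry preserves the optimal cost `transportCost p`, since the outer exponent is positive.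
Dirac measures can be recognised from this cost alone: in an ultrametric space a Dirac measure never
satisfies T(α, δ) + T(δ, β) ≤ T(α, β) unless α or β equals δ, while a non-Dirac μ is a mixture of
its conditionings on a set and on its complement, and lies between them. So Φ permutes the Dirac
measures and induces an isometry ψ of X.

Since T(μ, δ_x) is the potential ∫ ρ(y, x)^p dμ(y), the measures Φ(μ) and ψ_#μ have the same
potential. The potential determines the measure: by the layer-cake formula ρ^p is a superposition of
the kernels 1[r < ρ]. Each is conditionally of negative type, because {ρ ≤ r} is a disjoint union of
squares of balls. Equal potentials leave no energy defect, so the measures agree on balls of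
arbitrarily small radii. -/

open Set Metric ProbabilityTheory

/-! ### Sums of squares over a countable disjoint family -/

section Kernel

/-- For countably many disjoint measurable sets, the product measure of the union of the squares,
as a sum over the sets. -/
theorem hasSum_prod_real_iUnion_square {X ι : Type*} [MeasurableSpace X] [Countable ι]
    {B : ι → Set X} (hB : ∀ i, MeasurableSet (B i)) (hd : Pairwise (Function.onFun Disjoint B))
    (μ ν : Measure X) [IsFiniteMeasure μ] [IsFiniteMeasure ν] :
    HasSum (fun i => μ.real (B i) * ν.real (B i)) ((μ.prod ν).real (⋃ i, B i ×ˢ B i)) := by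
  have hdis : Pairwise (Function.onFun Disjoint fun i => B i ×ˢ B i) := fun i j hij =>
    Set.disjoint_prod.2 (Or.inl (hd hij))
  have h := measure_iUnion (μ := μ.prod ν) hdis fun i => (hB i).prod (hB i)
  have hne : ∑' i, μ.prod ν (B i ×ˢ B i) ≠ ∞ := h ▸ measure_ne_top _ _
  have hs := ENNReal.hasSum_toReal hne
  rw [← ENNReal.tsum_toReal_eq (fun i => measure_ne_top _ _), ← h] at hs
  simpa [Measure.real, Measure.prod_prod] using hs

theorem hasSum_sq_sub_measureReal {X ι : Type*} [MeasurableSpace X] [Countable ι]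
    {B : ι → Set X} (hB : ∀ i, MeasurableSet (B i)) (hd : Pairwise (Function.onFun Disjoint B))
    (μ ν : Measure X) [IsFiniteMeasure μ] [IsFiniteMeasure ν] :
    HasSum (fun i => (μ.real (B i) - ν.real (B i)) ^ 2)
      ((μ.prod μ).real (⋃ i, B i ×ˢ B i) + (ν.prod ν).real (⋃ i, B i ×ˢ B i)
        - 2 * (μ.prod ν).real (⋃ i, B i ×ˢ B i)) := by
  have h := ((hasSum_prod_real_iUnion_square hB hd μ μ).add
    (hasSum_prod_real_iUnion_square hB hd ν ν)).sub
    ((hasSum_prod_real_iUnion_square hB hd μ ν).mul_left 2)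
  refine (funext fun i => ?_ : (fun i => (μ.real (B i) - ν.real (B i)) ^ 2) = _) ▸ h
  ring

end Kernel

/-! ### Balls and threshold kernels in ultrametric spaces -/

section Ultrametric

variable {X : Type*} [MetricSpace X] [IsUltrametricDist X]

theorem IsUltrametricDist.countable_range_closedBall [TopologicalSpace.SeparableSpace X] {r : ℝ}
    (hr : 0 < r) : (range fun x : X => closedBall x r).Countable := by
  refine Set.PairwiseDisjoint.countable_of_isOpen (s := id) ?_ ?_ ?_
  · rintro _ ⟨x, rfl⟩ _ ⟨y, rfl⟩ hne
    exact (IsUltrametricDist.closedBall_eq_or_disjoint x y r).resolve_left hne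
  · rintro _ ⟨x, rfl⟩
    exact IsUltrametricDist.isOpen_closedBall x hr.ne'
  · rintro _ ⟨x, rfl⟩
    exact ⟨x, mem_closedBall_self hr.le⟩

theorem IsUltrametricDist.iUnion_closedBall_prod_closedBall {r : ℝ} (hr : 0 < r) :
    ⋃ B : range fun x : X => closedBall x r, (B : Set X) ×ˢ (B : Set X) =
      {z : X × X | dist z.1 z.2 ≤ r} := by
  ext ⟨x, y⟩
  simp only [mem_iUnion, mem_prod, mem_ofPred_eq, Subtype.exists, mem_range, exists_prop]
  constructor
  · rintro ⟨_, ⟨a, rfl⟩, hx, hy⟩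
    rw [IsUltrametricDist.closedBall_eq_of_mem hy] at hx
    exact hx
  · intro h
    exact ⟨_, ⟨y, rfl⟩, h, mem_closedBall_self hr.le⟩

/-- The kernel `(x, y) ↦ 1[r < dist x y]` is conditionally of negative type, and strictly so up to
the values on balls of radius `r`. -/
theorem IsUltrametricDist.prod_real_dist_gt [TopologicalSpace.SeparableSpace X]
    [MeasurableSpace X] [BorelSpace X] {r : ℝ} (hr : 0 < r) (μ ν : Measure X)
    [IsProbabilityMeasure μ] [IsProbabilityMeasure ν] :
    (μ.prod μ).real {z | r < dist z.1 z.2} + (ν.prod ν).real {z | r < dist z.1 z.2} ≤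
        2 * (μ.prod ν).real {z | r < dist z.1 z.2} ∧
      ((μ.prod μ).real {z | r < dist z.1 z.2} + (ν.prod ν).real {z | r < dist z.1 z.2} =
        2 * (μ.prod ν).real {z | r < dist z.1 z.2} →
        ∀ x, μ (closedBall x r) = ν (closedBall x r)) := by
  have := UniformSpace.secondCountable_of_separable X
  have hc := (countable_range_closedBall (X := X) hr).to_subtype
  have hsum := hasSum_sq_sub_measureReal (ι := range fun x : X => closedBall x r)
    (B := fun B => (B : Set X))
    (by rintro ⟨_, x, rfl⟩; exact measurableSet_closedBall)
    (by
      rintro ⟨_, x, rfl⟩ ⟨_, y, rfl⟩ hne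
      exact (IsUltrametricDist.closedBall_eq_or_disjoint x y r).resolve_left
        fun h => hne (Subtype.ext h)) μ ν
  rw [iUnion_closedBall_prod_closedBall hr] at hsum
  have hm : MeasurableSet {z : X × X | dist z.1 z.2 ≤ r} :=
    measurableSet_le (by fun_prop) (by fun_prop)
  have hcompl : {z : X × X | r < dist z.1 z.2} = {z : X × X | dist z.1 z.2 ≤ r}ᶜ := by
    ext z; simp
  -- On complements the constants cancel: the energy defect is the sum of (μ B - ν B)² over the
  -- balls B of radius r.
  rw [hcompl, probReal_compl_eq_one_sub hm, probReal_compl_eq_one_sub hm,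
    probReal_compl_eq_one_sub hm]
  refine ⟨by linarith [hsum.nonneg fun i => sq_nonneg _], fun h x => ?_⟩
  have h0 : HasSum (fun B : range fun x : X => closedBall x r =>
      (μ.real (B : Set X) - ν.real (B : Set X)) ^ 2) 0 := by
    convert hsum using 1; linarith
  have hx := congrFun ((hasSum_zero_iff_of_nonneg fun i => sq_nonneg _).1 h0)
    ⟨_, x, rfl⟩
  have hx' : μ.real (closedBall x r) = ν.real (closedBall x r) := by
    simpa [sub_eq_zero] using hx
  exact (measureReal_eq_measureReal_iff).1 hx'

/-- Two probability measures on a separable ultrametric space that agree on all closed balls with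
arbitrarily small positive radii from a fixed set are equal. -/
theorem IsUltrametricDist.measure_ext_closedBall [TopologicalSpace.SeparableSpace X]
    [MeasurableSpace X] [BorelSpace X] {μ ν : Measure X}
    [IsProbabilityMeasure μ] [IsProbabilityMeasure ν] {R : Set ℝ} (hR : ∀ r ∈ R, 0 < r)
    (hR0 : ∀ ε > 0, ∃ r ∈ R, r < ε)
    (h : ∀ r ∈ R, ∀ x, μ (closedBall x r) = ν (closedBall x r)) : μ = ν := by
  have := UniformSpace.secondCountable_of_separable X
  let C : Set (Set X) := {B | ∃ r ∈ R, ∃ x, B = closedBall x r}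
  have hbasis : TopologicalSpace.IsTopologicalBasis C := by
    refine TopologicalSpace.isTopologicalBasis_of_isOpen_of_nhds ?_ ?_
    · rintro _ ⟨r, hr, x, rfl⟩
      exact IsUltrametricDist.isOpen_closedBall x (hR r hr).ne'
    · intro x U hx hU
      obtain ⟨ε, hε, hεU⟩ := Metric.isOpen_iff.1 hU x hx
      obtain ⟨r, hr, hrε⟩ := hR0 ε hε
      exact ⟨_, ⟨r, hr, x, rfl⟩, mem_closedBall_self (hR r hr).le,
        (closedBall_subset_ball hrε).trans hεU⟩
  refine ext_of_generate_finite C ?_ ?_ ?_ (by simp)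
  · rw [‹BorelSpace X›.measurable_eq, hbasis.borel_eq_generateFrom]
  · rintro _ ⟨r, hr, x, rfl⟩ _ ⟨s, hs, y, rfl⟩ hne
    rcases IsUltrametricDist.closedBall_subset_trichotomy x y r s with h | h | h
    · rw [inter_eq_left.2 h]; exact ⟨r, hr, x, rfl⟩
    · rw [inter_eq_right.2 h]; exact ⟨s, hs, y, rfl⟩
    · exact absurd h (Set.not_disjoint_iff_nonempty_inter.2 hne)
  · rintro _ ⟨r, hr, x, rfl⟩
    exact h r hr x

theorem IsUltrametricDist.edist_triangle_max (x y z : X) :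
    edist x z ≤ max (edist x y) (edist y z) := by
  simp only [edist_dist]
  rw [← ENNReal.ofReal_max]
  exact ENNReal.ofReal_le_ofReal (dist_triangle_max x y z)

/-- The larger of the two legs already dominates the direct distance, so the smaller leg is pure
excess. -/
theorem IsUltrametricDist.edist_rpow_add_min_le {p : ℝ} (hp : 0 < p) (x y z : X) :
    edist x z ^ p + min (edist x y ^ p) (edist y z ^ p) ≤ edist x y ^ p + edist y z ^ p := by
  rw [← max_add_min (edist x y ^ p)]
  refine add_le_add_left ?_ _
  rw [← (ENNReal.monotone_rpow_of_nonneg hp.le).map_max]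
  exact ENNReal.rpow_le_rpow (edist_triangle_max x y z) hp.le

end Ultrametric

/-! ### A measure is determined by its potential -/

section Energy

variable {X : Type*} [MetricSpace X] [TopologicalSpace.SeparableSpace X] [MeasurableSpace X]
  [BorelSpace X]

theorem lintegral_prod_edist_rpow_eq_lintegral_meas_dist_gt {p : ℝ} (hp : 0 < p)
    (μ ν : Measure X) :
    ∫⁻ z, edist z.1 z.2 ^ p ∂(μ.prod ν) =
      ∫⁻ t in Ioi (0 : ℝ), (μ.prod ν) {z | t ^ p⁻¹ < dist z.1 z.2} := by
  have := UniformSpace.secondCountable_of_separable X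
  have h := lintegral_eq_lintegral_meas_lt (μ.prod ν) (f := fun z : X × X => dist z.1 z.2 ^ p)
    (.of_forall fun z => by positivity) (by fun_prop)
  have he : ∀ z : X × X, ENNReal.ofReal (dist z.1 z.2 ^ p) = edist z.1 z.2 ^ p := fun z => by
    rw [edist_dist, ENNReal.ofReal_rpow_of_nonneg dist_nonneg hp.le]
  simp only [he] at h
  rw [h]
  refine setLIntegral_congr_fun measurableSet_Ioi fun t ht => ?_
  simp only [Real.rpow_inv_lt_iff_of_pos (le_of_lt ht) dist_nonneg hp]

variable [IsUltrametricDist X]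

/-- A probability measure on a separable ultrametric space is determined by its potential with
respect to `edist ^ p`. -/
theorem IsUltrametricDist.measure_ext_lintegral_edist_rpow {p : ℝ} (hp : 0 < p) {μ ν : Measure X}
    [IsProbabilityMeasure μ] [IsProbabilityMeasure ν]
    {x₀ : X} (hμ : ∫⁻ x, edist x x₀ ^ p ∂μ < ∞)
    (h : ∀ y, ∫⁻ x, edist x y ^ p ∂μ = ∫⁻ x, edist x y ^ p ∂ν) : μ = ν := by
  have := UniformSpace.secondCountable_of_separable X
  have hm : Measurable fun z : X × X => edist z.1 z.2 ^ p := by fun_prop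
  have hE : ∀ α β : Measure X, [IsProbabilityMeasure α] → [IsProbabilityMeasure β] →
      ∫⁻ z, edist z.1 z.2 ^ p ∂(α.prod β) = ∫⁻ y, ∫⁻ x, edist x y ^ p ∂α ∂β :=
    fun α β _ _ => lintegral_prod_symm' _ hm
  have hμν : ∫⁻ z, edist z.1 z.2 ^ p ∂(μ.prod ν) = ∫⁻ z, edist z.1 z.2 ^ p ∂(ν.prod ν) := by
    rw [hE, hE]; simp only [h]
  have hμμ : ∫⁻ z, edist z.1 z.2 ^ p ∂(μ.prod μ) = ∫⁻ z, edist z.1 z.2 ^ p ∂(μ.prod ν) := by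
    rw [hE μ μ, lintegral_prod _ hm.aemeasurable]
    simp only [h]
    simp only [edist_comm]
  have hfin : ∫⁻ z, edist z.1 z.2 ^ p ∂(μ.prod μ) ≠ ∞ := by
    have hle : ∀ z : X × X, edist z.1 z.2 ^ p ≤ edist z.1 x₀ ^ p + edist z.2 x₀ ^ p := fun z => by
      rw [edist_comm z.2]
      exact le_self_add.trans (edist_rpow_add_min_le hp z.1 x₀ z.2)
    refine ((lintegral_mono hle).trans_lt ?_).ne
    rw [lintegral_add_left (by fun_prop), lintegral_prod _ (by fun_prop),
      lintegral_prod _ (by fun_prop)]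
    simpa using hμ
  let F : Measure X → Measure X → ℝ → ℝ≥0∞ := fun α β t =>
    (α.prod β) {z | t ^ p⁻¹ < dist z.1 z.2}
  have hFm : ∀ α β, AEMeasurable (F α β) (volume.restrict (Ioi 0)) := fun α β => by
    refine aemeasurable_restrict_of_antitoneOn measurableSet_Ioi fun s hs t ht hst => ?_
    refine measure_mono fun z hz => ?_
    exact (Real.rpow_le_rpow (le_of_lt hs) hst (by positivity)).trans_lt hz
  have hle : ∀ᵐ t ∂(volume.restrict (Ioi (0 : ℝ))), F μ μ t + F ν ν t ≤ F μ ν t + F μ ν t := by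
    filter_upwards [ae_restrict_mem measurableSet_Ioi] with t ht
    have := (prod_real_dist_gt (Real.rpow_pos_of_pos ht p⁻¹) μ ν).1
    rw [← ENNReal.toReal_le_toReal (by finiteness) (by finiteness),
      ENNReal.toReal_add (by finiteness) (by finiteness),
      ENNReal.toReal_add (by finiteness) (by finiteness)]
    simpa [F, Measure.real, two_mul] using this
  simp only [lintegral_prod_edist_rpow_eq_lintegral_meas_dist_gt hp] at hμν hμμ hfin
  -- Both sides of `hle` have the same finite integral over t, so the inequality is an equality for
  -- almost every t.
  have hae := ae_eq_of_ae_le_of_lintegral_le hle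
    (by
      rw [lintegral_add_left' (hFm _ _)]
      exact ENNReal.add_ne_top.2 ⟨hfin, by rw [← hμν, ← hμμ]; exact hfin⟩)
    ((hFm _ _).add (hFm _ _))
    (by
      rw [lintegral_add_left' (hFm _ _), lintegral_add_left' (hFm _ _)]
      exact le_of_eq (congrArg₂ (· + ·) hμμ.symm hμν))
  refine measure_ext_closedBall
    (R := {r | 0 < r ∧ ∀ x, μ (closedBall x r) = ν (closedBall x r)}) (fun r hr => hr.1) ?_
    fun r hr => hr.2
  intro ε hε
  have hεp : 0 < ε ^ p := Real.rpow_pos_of_pos hε p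
  -- This interval has positive length, so it contains a good t; the radius t^(1/p) is then below ε.
  have hne : (ae (volume.restrict (Ioo 0 (ε ^ p)))).NeBot := by
    rw [ae_neBot, Ne, Measure.restrict_eq_zero]
    simpa using hεp
  have hae' : ∀ᵐ t ∂(volume.restrict (Ioo 0 (ε ^ p))), F μ μ t + F ν ν t = F μ ν t + F μ ν t :=
    Filter.Eventually.filter_mono (ae_mono (Measure.restrict_mono Ioo_subset_Ioi_self le_rfl)) hae
  obtain ⟨t, ht, ht0, htε⟩ := (hae'.and (ae_restrict_mem measurableSet_Ioo)).exists
  have hr : 0 < t ^ p⁻¹ := Real.rpow_pos_of_pos ht0 _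
  refine ⟨t ^ p⁻¹, ⟨hr, (prod_real_dist_gt hr μ ν).2 ?_⟩,
    (Real.rpow_inv_lt_iff_of_pos ht0.le hε.le hp).2 htε⟩
  have := congrArg ENNReal.toReal ht
  rw [ENNReal.toReal_add (by finiteness) (by finiteness),
      ENNReal.toReal_add (by finiteness) (by finiteness)] at this
  simpa [F, Measure.real, two_mul] using this

end Energy

namespace WassersteinSpace

theorem prod_mem_couplings {X : Type*} [MeasurableSpace X] (μ ν : Measure X) [IsProbabilityMeasure μ] [IsProbabilityMeasure ν] :
    μ.prod ν ∈ couplings μ ν := ⟨by simp, by simp⟩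

/-! ### Optimal cost and the betweenness test for Dirac measures -/

section Cost

variable {X : Type*} [MetricSpace X] [MeasurableSpace X] {p : ℝ}

instance (μ : WassersteinSpace p X) : IsProbabilityMeasure μ.toMeasure :=
  inferInstanceAs (IsProbabilityMeasure (μ.1 : Measure X))

theorem toMeasure_injective :
    Function.Injective (toMeasure : WassersteinSpace p X → Measure X) := fun _ _ h =>
  Subtype.ext (Subtype.ext h)

/-- A probability measure of finite `p`-th moment as a point of the Wasserstein space. -/
def ofMeasure (μ : Measure X) [IsProbabilityMeasure μ]
    (h : ∃ x₀ : X, ∫⁻ x, edist x x₀ ^ p ∂μ < ∞) : WassersteinSpace p X :=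
  ⟨⟨μ, inferInstance⟩, h⟩

@[simp]
theorem toMeasure_ofMeasure (μ : Measure X) [IsProbabilityMeasure μ]
    (h : ∃ x₀ : X, ∫⁻ x, edist x x₀ ^ p ∂μ < ∞) : (ofMeasure μ h).toMeasure = μ := rfl

/-- The optimal cost of transporting `μ` to `ν` for the cost function `edist ^ p`. -/
noncomputable def transportCost (p : ℝ) (μ ν : Measure X) : ℝ≥0∞ :=
  ⨅ π ∈ couplings μ ν, ∫⁻ z, edist z.1 z.2 ^ p ∂π

theorem transportCost_le_prod (μ ν : Measure X) [IsProbabilityMeasure μ]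
    [IsProbabilityMeasure ν] :
    transportCost p μ ν ≤ ∫⁻ z, edist z.1 z.2 ^ p ∂(μ.prod ν) :=
  iInf₂_le _ (prod_mem_couplings μ ν)

theorem wassersteinDist_eq_iff (hp : 0 < p) {μ ν μ' ν' : WassersteinSpace p X} :
    wassersteinDist μ ν = wassersteinDist μ' ν' ↔
      transportCost p μ.toMeasure ν.toMeasure = transportCost p μ'.toMeasure ν'.toMeasure :=
  (ENNReal.rpow_left_injective (by positivity)).eq_iff

theorem transportCost_lt_top [BorelSpace X] (hp : 0 < p) (μ ν : WassersteinSpace p X) :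
    transportCost p μ.toMeasure ν.toMeasure < ∞ :=
  (ENNReal.rpow_lt_top_iff_of_pos (by positivity)).1 (wassersteinDist_lt_top hp μ ν)

theorem exists_lintegral_cond_edist_rpow_lt_top (μ : WassersteinSpace p X) {B : Set X}
    (hB : μ.toMeasure B ≠ 0) : ∃ x₀ : X, ∫⁻ x, edist x x₀ ^ p ∂(μ.toMeasure[|B]) < ∞ := by
  obtain ⟨x₀, hx₀⟩ := μ.2
  refine ⟨x₀, ?_⟩
  rw [ProbabilityTheory.cond, lintegral_smul_measure]
  exact ENNReal.mul_lt_top (ENNReal.inv_lt_top.2 (pos_iff_ne_zero.2 hB))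
    ((setLIntegral_le_lintegral _ _).trans_lt hx₀)

variable [TopologicalSpace.SeparableSpace X] [BorelSpace X]

theorem transportCost_dirac_right (μ : Measure X) [IsProbabilityMeasure μ] (x : X) :
    transportCost p μ (Measure.dirac x) = ∫⁻ y, edist y x ^ p ∂μ := by
  have := UniformSpace.secondCountable_of_separable X
  refine le_antisymm ((transportCost_le_prod _ _).trans_eq ?_) (le_iInf₂ fun π hπ => ?_)
  · rw [lintegral_prod _ (by fun_prop)]
    simp
  · obtain ⟨h1, h2⟩ := hπ
    have hx : ∀ᵐ z ∂π, z.2 = x := by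
      have : ∀ᵐ y ∂π.snd, y = x := by rw [h2, ae_dirac_eq]; simp
      exact ae_of_ae_map measurable_snd.aemeasurable this
    rw [← h1, Measure.fst, lintegral_map (by fun_prop) measurable_fst]
    refine le_of_eq (lintegral_congr_ae ?_)
    filter_upwards [hx] with z hz
    rw [hz]

theorem transportCost_dirac_left (μ : Measure X) [IsProbabilityMeasure μ] (x : X) :
    transportCost p (Measure.dirac x) μ = ∫⁻ y, edist x y ^ p ∂μ := by
  have := UniformSpace.secondCountable_of_separable X
  refine le_antisymm ((transportCost_le_prod _ _).trans_eq ?_) (le_iInf₂ fun π hπ => ?_)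
  · rw [lintegral_prod _ (by fun_prop)]
    simp
  · obtain ⟨h1, h2⟩ := hπ
    have hx : ∀ᵐ z ∂π, z.1 = x := by
      have : ∀ᵐ y ∂π.fst, y = x := by rw [h1, ae_dirac_eq]; simp
      exact ae_of_ae_map measurable_fst.aemeasurable this
    rw [← h2, Measure.snd, lintegral_map (by fun_prop) measurable_snd]
    refine le_of_eq (lintegral_congr_ae ?_)
    filter_upwards [hx] with z hz
    rw [hz]

/-- A Dirac measure in an ultrametric space is not strictly between two other measures. -/
theorem eq_dirac_or_eq_dirac_of_transportCost_add_le [IsUltrametricDist X] (hp : 0 < p)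
    {α β : WassersteinSpace p X} {x : X}
    (h : transportCost p α.toMeasure (Measure.dirac x) +
      transportCost p (Measure.dirac x) β.toMeasure ≤
        transportCost p α.toMeasure β.toMeasure) :
    α.toMeasure = Measure.dirac x ∨ β.toMeasure = Measure.dirac x := by
  have := UniformSpace.secondCountable_of_separable X
  set a := α.toMeasure
  set b := β.toMeasure
  have hsum : ∫⁻ z, (edist z.1 x ^ p + edist x z.2 ^ p) ∂(a.prod b) =
      transportCost p a (Measure.dirac x) + transportCost p (Measure.dirac x) b := by
    rw [lintegral_add_left (by fun_prop), lintegral_prod _ (by fun_prop),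
      lintegral_prod _ (by fun_prop), transportCost_dirac_right, transportCost_dirac_left]
    simp
  -- The product coupling bounds T(α, β) from above, so the hypothesis leaves no room for the
  -- excess.
  have hle : (∫⁻ z, edist z.1 z.2 ^ p ∂(a.prod b)) +
      ∫⁻ z, min (edist z.1 x ^ p) (edist x z.2 ^ p) ∂(a.prod b) ≤
      ∫⁻ z, edist z.1 z.2 ^ p ∂(a.prod b) := by
    rw [← lintegral_add_left (by fun_prop)]
    refine (lintegral_mono fun z : X × X =>
      IsUltrametricDist.edist_rpow_add_min_le hp z.1 x z.2).trans ?_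
    rw [hsum]
    exact h.trans (transportCost_le_prod _ _)
  have hfin : ∫⁻ z, edist z.1 z.2 ^ p ∂(a.prod b) ≠ ∞ := by
    refine ((lintegral_mono fun z : X × X => le_self_add.trans
      (IsUltrametricDist.edist_rpow_add_min_le hp z.1 x z.2)).trans_lt ?_).ne
    rw [hsum]
    exact h.trans_lt (transportCost_lt_top hp α β)
  have hzero : ∫⁻ z, min (edist z.1 x ^ p) (edist x z.2 ^ p) ∂(a.prod b) = 0 := by
    by_contra hne
    exact absurd hle (not_le.2 (ENNReal.lt_add_right hfin hne))
  rw [lintegral_eq_zero_iff (by fun_prop)] at hzero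
  have hnull : (a.prod b) ({x}ᶜ ×ˢ {x}ᶜ) = 0 := by
    refine measure_mono_null (fun z hz => ?_) hzero
    simpa [hp, hp.le, hp.ne', eq_comm (a := x)] using hz
  have key : ∀ c : Measure X, [IsProbabilityMeasure c] → c {x}ᶜ = 0 → c = Measure.dirac x := by
    intro c _ hc
    have : c.restrict {x} = c := Measure.restrict_eq_self_of_ae_mem hc
    rw [← this, Measure.restrict_singleton, (prob_compl_eq_zero_iff (.singleton x)).1 hc,
      one_smul]
  rw [Measure.prod_prod, mul_eq_zero] at hnull
  exact hnull.imp (key a) (key b)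

/-- Given a plan π from α to β, move only a share t of it to reach the mixture, then the remaining
share s; the mass left on the diagonal costs nothing. -/
theorem transportCost_add_smul_le (hp : 0 < p) {s t : ℝ≥0∞} (hst : s + t = 1) (α β : Measure X) :
    transportCost p α (s • α + t • β) + transportCost p (s • α + t • β) β ≤
      transportCost p α β := by
  have := UniformSpace.secondCountable_of_separable X
  refine le_iInf₂ fun π hπ => ?_
  obtain ⟨h1, h2⟩ := hπ
  have hdiag : ∀ γ : Measure X, (γ.map fun x => (x, x)).fst = γ ∧
      (γ.map fun x => (x, x)).snd = γ ∧
      ∫⁻ z, edist z.1 z.2 ^ p ∂(γ.map fun x => (x, x)) = 0 := fun γ => by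
    refine ⟨?_, ?_, ?_⟩
    · rw [Measure.fst_map_prodMk measurable_id']; exact Measure.map_id'
    · rw [Measure.snd_map_prodMk measurable_id']; exact Measure.map_id'
    · rw [lintegral_map (by fun_prop) (by fun_prop)]; simp [hp]
  have hl : s • (α.map fun x => (x, x)) + t • π ∈ couplings α (s • α + t • β) := by
    constructor
    · rw [Measure.fst, Measure.map_add _ _ measurable_fst, Measure.map_smul, Measure.map_smul]
      change s • Measure.fst _ + t • Measure.fst _ = _
      rw [(hdiag α).1, h1, ← add_smul, hst, one_smul]
    · rw [Measure.snd, Measure.map_add _ _ measurable_snd, Measure.map_smul, Measure.map_smul]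
      change s • Measure.snd _ + t • Measure.snd _ = _
      rw [(hdiag α).2.1, h2]
  have hr : s • π + t • (β.map fun x => (x, x)) ∈ couplings (s • α + t • β) β := by
    constructor
    · rw [Measure.fst, Measure.map_add _ _ measurable_fst, Measure.map_smul, Measure.map_smul]
      change s • Measure.fst _ + t • Measure.fst _ = _
      rw [(hdiag β).1, h1]
    · rw [Measure.snd, Measure.map_add _ _ measurable_snd, Measure.map_smul, Measure.map_smul]
      change s • Measure.snd _ + t • Measure.snd _ = _
      rw [(hdiag β).2.1, h2, ← add_smul, hst, one_smul]
  refine (add_le_add (iInf₂_le _ hl) (iInf₂_le _ hr)).trans_eq ?_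
  simp only [lintegral_add_measure, lintegral_smul_measure, (hdiag _).2.2, smul_eq_mul, mul_zero,
    zero_add, add_zero]
  rw [← add_mul, add_comm t, hst, one_mul]

/-- A measure that is not a Dirac measure is strictly between two other measures. -/
theorem exists_transportCost_add_le_of_ne_dirac [CompleteSpace X] (hp : 0 < p)
    {μ : WassersteinSpace p X} (h : ∀ x, μ.toMeasure ≠ Measure.dirac x) :
    ∃ α β : WassersteinSpace p X, α ≠ μ ∧ β ≠ μ ∧
      transportCost p α.toMeasure μ.toMeasure + transportCost p μ.toMeasure β.toMeasure ≤
        transportCost p α.toMeasure β.toMeasure := by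
  have := UniformSpace.secondCountable_of_separable X
  -- A probability measure with only the values 0 and 1 would be a Dirac measure.
  have hB : ∃ B, MeasurableSet B ∧ μ.toMeasure B ≠ 0 ∧ μ.toMeasure B ≠ 1 := by
    by_contra! hcon
    have : IsZeroOneMeasure μ.toMeasure :=
      ⟨fun s hs => or_iff_not_imp_left.2 fun h0 => hcon s hs h0⟩
    obtain ⟨x, hx⟩ := IsZeroOneMeasure.exists_eq_dirac (μ := μ.toMeasure)
    exact h x hx
  obtain ⟨B, hBm, hB0, hB1⟩ := hB
  have hBc0 : μ.toMeasure Bᶜ ≠ 0 := fun h0 => hB1 ((prob_compl_eq_zero_iff hBm).1 h0)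
  have i1 : IsProbabilityMeasure (μ.toMeasure[|B]) := cond_isProbabilityMeasure hB0
  have i2 : IsProbabilityMeasure (μ.toMeasure[|Bᶜ]) := cond_isProbabilityMeasure hBc0
  have hdec : μ.toMeasure B • μ.toMeasure[|B] + μ.toMeasure Bᶜ • μ.toMeasure[|Bᶜ] =
      μ.toMeasure := by
    ext s hs
    simpa [mul_comm] using cond_add_cond_compl_eq hBm μ.toMeasure (t := s)
  refine ⟨ofMeasure _ (exists_lintegral_cond_edist_rpow_lt_top μ hB0),
    ofMeasure _ (exists_lintegral_cond_edist_rpow_lt_top μ hBc0), fun he => ?_, fun he => ?_, ?_⟩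
  · refine hBc0 ?_
    rw [← he, toMeasure_ofMeasure, cond_apply hBm]
    simp
  · refine hB0 ?_
    rw [← he, toMeasure_ofMeasure, cond_apply hBm.compl]
    simp
  · have := transportCost_add_smul_le hp (prob_add_prob_compl (μ := μ.toMeasure) hBm)
      (μ.toMeasure[|B]) (μ.toMeasure[|Bᶜ])
    rwa [hdec] at this

end Cost

/-! ### The isometry of X induced on Dirac measures -/

section Isometry

variable {X : Type*} [MetricSpace X] [MeasurableSpace X] {p : ℝ}

/-- The Dirac measure at `x` as a point of the Wasserstein space. -/
noncomputable def dirac [BorelSpace X] (hp : 0 < p) (x : X) : WassersteinSpace p X :=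
  ofMeasure (Measure.dirac x) ⟨x, by simp [hp]⟩

@[simp]
theorem toMeasure_dirac [BorelSpace X] (hp : 0 < p) (x : X) :
    (dirac hp x).toMeasure = Measure.dirac x := rfl

variable [CompleteSpace X] [TopologicalSpace.SeparableSpace X] [IsUltrametricDist X]
  [BorelSpace X]

theorem exists_apply_dirac_eq (hp : 0 < p) {Φ : WassersteinSpace p X → WassersteinSpace p X}
    (hΦ : Function.Surjective Φ)
    (hT : ∀ μ ν, transportCost p (Φ μ).toMeasure (Φ ν).toMeasure =
      transportCost p μ.toMeasure ν.toMeasure) (x : X) : ∃ y, Φ (dirac hp x) = dirac hp y := by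
  by_contra! hcon
  obtain ⟨α, β, hα, hβ, hle⟩ := exists_transportCost_add_le_of_ne_dirac hp
    (μ := Φ (dirac hp x)) fun y hy => hcon y (toMeasure_injective hy)
  obtain ⟨α, rfl⟩ := hΦ α
  obtain ⟨β, rfl⟩ := hΦ β
  rw [hT, hT, hT] at hle
  rcases eq_dirac_or_eq_dirac_of_transportCost_add_le hp hle with h | h
  · exact hα (congrArg Φ (toMeasure_injective h))
  · exact hβ (congrArg Φ (toMeasure_injective h))

theorem exists_isometryEquiv_apply_dirac (hp : 0 < p)
    {Φ : WassersteinSpace p X → WassersteinSpace p X} (hΦ : Function.Bijective Φ)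
    (hT : ∀ μ ν, transportCost p (Φ μ).toMeasure (Φ ν).toMeasure =
      transportCost p μ.toMeasure ν.toMeasure) :
    ∃ ψ : X ≃ᵢ X, ∀ x, Φ (dirac hp x) = dirac hp (ψ x) := by
  choose ψ hψ using exists_apply_dirac_eq hp hΦ.2 hT
  let e := Equiv.ofBijective Φ hΦ
  have hTs : ∀ μ ν, transportCost p (e.symm μ).toMeasure (e.symm ν).toMeasure =
      transportCost p μ.toMeasure ν.toMeasure := fun μ ν => by
    rw [← hT]
    exact congrArg₂ (fun a b => transportCost p (toMeasure a) (toMeasure b))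
      (e.apply_symm_apply μ) (e.apply_symm_apply ν)
  have hiso : Isometry ψ := fun x y => by
    have h := hT (dirac hp x) (dirac hp y)
    simp only [hψ, toMeasure_dirac, transportCost_dirac_right, lintegral_dirac] at h
    exact ENNReal.rpow_left_injective hp.ne' h
  -- The inverse of Φ also preserves the cost, so it sends Dirac measures to Dirac measures.
  have hsurj : Function.Surjective ψ := fun y => by
    obtain ⟨x, hx⟩ := exists_apply_dirac_eq hp e.symm.surjective hTs y
    refine ⟨x, ?_⟩
    have h : dirac hp y = dirac hp (ψ x) := by
      rw [← hψ, ← hx]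
      exact (e.apply_symm_apply _).symm
    have h' := congrArg toMeasure h
    exact ((dirac_eq_dirac_iff).1 h').symm
  exact ⟨⟨Equiv.ofBijective ψ ⟨hiso.injective, hsurj⟩, hiso⟩, hψ⟩

end Isometry

end WassersteinSpace

open WassersteinSpace in
theorem mainTheorem7 {X : Type*} [MetricSpace X] [CompleteSpace X]
    [TopologicalSpace.SeparableSpace X] [IsUltrametricDist X] [MeasurableSpace X] [BorelSpace X]
    (p : ℝ) (hp : 0 < p) (Φ : WassersteinSpace p X → WassersteinSpace p X)
    (hΦ_bij : Function.Bijective Φ)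
    (hΦ_dist : ∀ μ ν : WassersteinSpace p X,
      WassersteinSpace.wassersteinDist (Φ μ) (Φ ν) = WassersteinSpace.wassersteinDist μ ν) :
    ∃ ψ : X ≃ᵢ X, ∀ μ : WassersteinSpace p X, (Φ μ).toMeasure = μ.toMeasure.map ψ := by
  have := UniformSpace.secondCountable_of_separable X
  have hT : ∀ μ ν, transportCost p (Φ μ).toMeasure (Φ ν).toMeasure =
      transportCost p μ.toMeasure ν.toMeasure := fun μ ν =>
    (wassersteinDist_eq_iff hp).1 (hΦ_dist μ ν)
  obtain ⟨ψ, hψ⟩ := exists_isometryEquiv_apply_dirac hp hΦ_bij hT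
  refine ⟨ψ, fun μ => ?_⟩
  have hψm : Measurable ψ := ψ.continuous.measurable
  have : IsProbabilityMeasure (μ.toMeasure.map ψ) :=
    Measure.isProbabilityMeasure_map hψm.aemeasurable
  obtain ⟨x₀, hx₀⟩ := (Φ μ).2
  refine IsUltrametricDist.measure_ext_lintegral_edist_rpow hp hx₀ fun y => ?_
  -- Every point is some ψ x, so the potential of Φ μ there is the cost to Φ(δ_x), which equals the
  -- potential of μ at x.
  obtain ⟨x, rfl⟩ := ψ.surjective y
  have h := hT μ (dirac hp x)
  rw [hψ, toMeasure_dirac, toMeasure_dirac, transportCost_dirac_right,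
    transportCost_dirac_right] at h
  rw [h, lintegral_map (by fun_prop) hψm]
  simp only [ψ.isometry.edist_eq]
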